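/- For an integer $n\ge 1$ and real $x>0$ let $$\phi_n(x)=\int_0^\pi e^{-2x\sin\eta}\,e^{2in\eta}\,\mathrm{d}\eta .$$ Then $\phi_n(x)$ is real, and for every integer $n\ge 1$ and every $x>0$, $$\frac12\,\frac{(2n+1)x}{(n^2+x^2)\big((n+1)^2+x^2\big)}\;\le\;\phi_n(x)-\phi_{n+1}(x)\;\le\;4\,\frac{(2n+1)x}{(n^2+x^2)\big((n+1)^2+x^2\big)} .$$ -/

import Mathlib

/-- The universal function `φ_n(x) = ∫₀^π e^{-2 x sin η} e^{2 i n η} dη`. -/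
noncomputable def phi (n : ℕ) (x : ℝ) : ℂ :=
  ∫ η in (0 : ℝ)..Real.pi,
    Complex.exp (((-2 * x * Real.sin η : ℝ) : ℂ)) *
      Complex.exp (Complex.I * (2 * (n : ℂ) * (η : ℂ)))

open Filter Topology Set

/-! Write E = (x d/dx)². Two integrations by parts show that φ_n solves E φ = q_n φ - 4x with q_n =
4(x² + n²) (`phiReal_ode`). Dropping E φ leaves the approximate solution u_n = x/(x² + n²), and the
target fraction is exactly u_n - u_{n+1}. Since q_n > 0, the maximum principle turns bounds on E u_n
into bounds on φ_n/u_n (`phiReal_bounds`). Subtracting consecutive equations gives an equation for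
φ_n - φ_{n+1} with source 4(2n+1)φ_{n+1}. The bounds on φ_{n+1} control that source, and
`euler_profile_sub_bounds` allows a second comparison, with multiples of u_n - u_{n+1}. -/

/-- Weak maximum principle on `(0, ∞)` for the operator `q - (x d/dx)²` with `q > 0`. -/
theorem nonneg_of_euler_supersolution {f f' f'' q : ℝ → ℝ}
    (hf : ∀ x, 0 < x → HasDerivAt f (f' x) x)
    (hf' : ∀ x, 0 < x → HasDerivAt f' (f'' x) x)
    (hq : ∀ x, 0 < x → 0 < q x)
    (hsup : ∀ x, 0 < x → x ^ 2 * f'' x + x * f' x ≤ q x * f x)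
    (h0 : Tendsto f (𝓝[>] 0) (𝓝 0)) (htop : Tendsto f atTop (𝓝 0))
    (x : ℝ) (hx : 0 < x) : 0 ≤ f x := by
  by_contra! hneg
  obtain ⟨δ, hδ, hδf⟩ := mem_nhdsGT_iff_exists_Ioo_subset.1 (h0.eventually_const_lt hneg)
  obtain ⟨B, hB⟩ := eventually_atTop.1 (htop.eventually_const_lt hneg)
  have hδ : 0 < δ := hδ
  have hxδ : δ ≤ x := by
    by_contra! h
    exact lt_irrefl _ (show f x < f x from hδf ⟨hx, h⟩)
  have hxB : x ≤ B := by
    by_contra! h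
    exact lt_irrefl _ (hB x h.le)
  have hcont : ContinuousOn f (Icc δ B) := fun y hy =>
    (hf y (hδ.trans_le hy.1)).continuousAt.continuousWithinAt
  obtain ⟨z, hz, hmin⟩ := isCompact_Icc.exists_isMinOn ⟨x, hxδ, hxB⟩ hcont
  have hzx : f z ≤ f x := hmin ⟨hxδ, hxB⟩
  have hz0 : 0 < z := hδ.trans_le hz.1
  have hglob : ∀ y, 0 < y → f z ≤ f y := by
    intro y hy
    rcases lt_or_ge y δ with h | h
    · exact hzx.trans (show f x < f y from hδf ⟨hy, h⟩).le
    rcases le_or_gt y B with h' | h'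
    · exact hmin ⟨h, h'⟩
    · exact hzx.trans (hB y h'.le).le
  have hlmin : IsLocalMin f z := by
    filter_upwards [Ioi_mem_nhds hz0] with y hy using hglob y hy
  have hd0 : f' z = 0 := hlmin.hasDerivAt_eq_zero (hf z hz0)
  have hderiv : deriv f =ᶠ[𝓝 z] f' := by
    filter_upwards [Ioi_mem_nhds hz0] with y hy using (hf y hy).deriv
  have hneg2 : f'' z < 0 := by
    have h1 := hsup z hz0
    rw [hd0] at h1
    have h2 : q z * f z < 0 := mul_neg_of_pos_of_neg (hq z hz0) (hzx.trans_lt hneg)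
    have : 0 < z ^ 2 := by positivity
    by_contra! h
    nlinarith [mul_nonneg this.le h]
  -- The second-derivative test makes the minimum also a local maximum, so f is locally constant,
  -- contradicting f'' z < 0.
  have hlmax : IsLocalMax f z := by
    apply isLocalMax_of_deriv_deriv_neg
    · rw [hderiv.deriv_eq, (hf' z hz0).deriv]; exact hneg2
    · rw [hderiv.eq_of_nhds, hd0]
    · exact (hf z hz0).continuousAt
  have hconst : f =ᶠ[𝓝 z] fun _ => f z := by
    filter_upwards [hlmin, hlmax] with y h1 h2 using le_antisymm h2 h1
  have hz2 : deriv (deriv f) z = 0 := by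
    rw [hconst.deriv.deriv_eq]; simp
  rw [hderiv.deriv_eq, (hf' z hz0).deriv] at hz2
  exact hneg2.ne hz2

/-! ### Differentiation and decay of the integrals -/

/-- Laplace-type integral `∫₀^π e^{-2 x sin η} g(η) dη`. -/
noncomputable def sinLaplace (g : ℝ → ℝ) (x : ℝ) : ℝ :=
  ∫ η in (0 : ℝ)..Real.pi, Real.exp (-2 * x * Real.sin η) * g η

theorem hasDerivAt_sinLaplace {g : ℝ → ℝ} (hg : Continuous g) (x : ℝ) :
    HasDerivAt (sinLaplace g) (sinLaplace (fun η => -2 * Real.sin η * g η) x) x := by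
  have h := intervalIntegral.hasDerivAt_integral_of_dominated_loc_of_deriv_le
    (μ := MeasureTheory.volume) (a := (0 : ℝ)) (b := Real.pi)
    (F := fun x η => Real.exp (-2 * x * Real.sin η) * g η)
    (F' := fun x η => Real.exp (-2 * x * Real.sin η) * (-2 * Real.sin η * g η))
    (x₀ := x) (s := Metric.ball x 1)
    (bound := fun η => Real.exp (2 * (|x| + 1)) * (2 * |g η|))
    (Metric.ball_mem_nhds x one_pos)
    (Eventually.of_forall fun y => (by fun_prop : Continuous fun η =>
      Real.exp (-2 * y * Real.sin η) * g η).aestronglyMeasurable)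
    ((by fun_prop : Continuous fun η =>
      Real.exp (-2 * x * Real.sin η) * g η).intervalIntegrable _ _)
    ((by fun_prop : Continuous fun η =>
      Real.exp (-2 * x * Real.sin η) * (-2 * Real.sin η * g η)).aestronglyMeasurable)
    (Eventually.of_forall fun η _ y hy => ?_)
    ((by fun_prop : Continuous fun η =>
      Real.exp (2 * (|x| + 1)) * (2 * |g η|)).intervalIntegrable _ _)
    (Eventually.of_forall fun η _ y _ => ?_)
  · exact h.2
  · have hy' : |y| ≤ |x| + 1 := by
      have h1 : |y - x| < 1 := by simpa [Real.dist_eq] using hy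
      have h2 : |y| ≤ |y - x| + |x| := by simpa using abs_add_le (y - x) x
      linarith
    have hs := Real.abs_sin_le_one η
    rw [Real.norm_eq_abs, abs_mul, Real.abs_exp]
    gcongr ?_ * ?_
    · apply Real.exp_le_exp.2
      calc -2 * y * Real.sin η ≤ |-2 * y * Real.sin η| := le_abs_self _
        _ = 2 * |y| * |Real.sin η| := by simp [abs_mul]
        _ ≤ 2 * |y| * 1 := by gcongr
        _ ≤ 2 * (|x| + 1) := by linarith
    · rw [abs_mul, abs_mul]
      have : |(-2 : ℝ)| = 2 := by norm_num
      rw [this]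
      nlinarith [abs_nonneg (g η)]
  · have h1 : HasDerivAt (fun y : ℝ => -2 * y * Real.sin η) (-2 * Real.sin η) y := by
      simpa using ((hasDerivAt_id y).const_mul (-2)).mul_const (Real.sin η)
    exact (h1.exp.mul_const (g η)).congr_deriv (by ring)

theorem tendsto_sinLaplace_atTop {g : ℝ → ℝ} (hg : Continuous g) :
    Tendsto (sinLaplace g) atTop (𝓝 0) := by
  have h := intervalIntegral.tendsto_integral_filter_of_dominated_convergence
    (μ := MeasureTheory.volume) (a := (0 : ℝ)) (b := Real.pi) (l := atTop)
    (F := fun x η => Real.exp (-2 * x * Real.sin η) * g η) (f := fun _ => (0 : ℝ))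
    (fun η => |g η|)
    (Eventually.of_forall fun y => (by fun_prop : Continuous fun η =>
      Real.exp (-2 * y * Real.sin η) * g η).aestronglyMeasurable)
    ?_ ((by fun_prop : Continuous fun η => |g η|).intervalIntegrable _ _) ?_
  · rw [intervalIntegral.integral_zero] at h
    exact h
  · filter_upwards [eventually_ge_atTop 0] with x hx
    refine Eventually.of_forall fun η hη => ?_
    rw [uIoc_of_le Real.pi_pos.le] at hη
    have hs : 0 ≤ Real.sin η := Real.sin_nonneg_of_nonneg_of_le_pi hη.1.le hη.2
    rw [Real.norm_eq_abs, abs_mul, Real.abs_exp]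
    have : Real.exp (-2 * x * Real.sin η) ≤ 1 :=
      Real.exp_le_one_iff.2 (by nlinarith [mul_nonneg hx hs])
    nlinarith [abs_nonneg (g η)]
  -- At η = π the sine vanishes and the integrand does not decay.
  · have hpi : ∀ᵐ η ∂(MeasureTheory.volume : MeasureTheory.Measure ℝ), η ≠ Real.pi := by
      simp [MeasureTheory.ae_iff]
    filter_upwards [hpi] with η hne hη
    rw [uIoc_of_le Real.pi_pos.le] at hη
    have hs : 0 < Real.sin η := Real.sin_pos_of_pos_of_lt_pi hη.1 (lt_of_le_of_ne hη.2 hne)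
    have h1 : Tendsto (fun x : ℝ => -2 * x * Real.sin η) atTop atBot := by
      have := (tendsto_id (α := ℝ) (x := atTop)).const_mul_atTop_of_neg
        (show -2 * Real.sin η < 0 by linarith)
      refine this.congr fun x => ?_
      simp only [id]; ring
    simpa using (Real.tendsto_exp_atBot.comp h1).mul_const (g η)

/-- The real form `∫₀^π e^{-2 x sin η} cos (2 n η) dη` of `phi n x`. -/
noncomputable def phiReal (n : ℕ) : ℝ → ℝ := sinLaplace fun η => Real.cos (2 * n * η)

noncomputable def phiReal' (n : ℕ) : ℝ → ℝ :=
  sinLaplace fun η => -2 * Real.sin η * Real.cos (2 * n * η)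

noncomputable def phiReal'' (n : ℕ) : ℝ → ℝ :=
  sinLaplace fun η => -2 * Real.sin η * (-2 * Real.sin η * Real.cos (2 * n * η))

theorem hasDerivAt_phiReal (n : ℕ) (x : ℝ) : HasDerivAt (phiReal n) (phiReal' n x) x :=
  hasDerivAt_sinLaplace (by fun_prop) x

theorem hasDerivAt_phiReal' (n : ℕ) (x : ℝ) : HasDerivAt (phiReal' n) (phiReal'' n x) x :=
  hasDerivAt_sinLaplace (by fun_prop) x

theorem tendsto_phiReal_atTop (n : ℕ) : Tendsto (phiReal n) atTop (𝓝 0) :=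
  tendsto_sinLaplace_atTop (by fun_prop)

theorem sin_two_nat_mul_pi (n : ℕ) : Real.sin (2 * n * Real.pi) = 0 := by
  have := Real.sin_nat_mul_pi (2 * n)
  push_cast at this
  exact this

theorem cos_two_nat_mul_pi (n : ℕ) : Real.cos (2 * n * Real.pi) = 1 := by
  have := Real.cos_nat_mul_two_pi n
  rwa [show (n : ℝ) * (2 * Real.pi) = 2 * n * Real.pi by ring] at this

theorem phiReal_zero {n : ℕ} (hn : 1 ≤ n) : phiReal n 0 = 0 := by
  have hn0 : (2 * n : ℝ) ≠ 0 := by positivity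
  simp only [phiReal, sinLaplace]
  have hderiv : ∀ η ∈ uIcc 0 Real.pi, HasDerivAt (fun η => Real.sin (2 * n * η) / (2 * n))
      (Real.exp (-2 * 0 * Real.sin η) * Real.cos (2 * n * η)) η := by
    intro η _
    have h1 : HasDerivAt (fun η : ℝ => 2 * n * η) (2 * n) η := by
      simpa using (hasDerivAt_id η).const_mul (2 * n : ℝ)
    refine (h1.sin.div_const _).congr_deriv ?_
    field_simp
    simp
  rw [intervalIntegral.integral_eq_sub_of_hasDerivAt hderiv
    ((by fun_prop : Continuous _).intervalIntegrable _ _), sin_two_nat_mul_pi]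
  simp

theorem tendsto_phiReal_zero {n : ℕ} (hn : 1 ≤ n) : Tendsto (phiReal n) (𝓝[>] 0) (𝓝 0) := by
  have h := (hasDerivAt_phiReal n 0).continuousAt.tendsto
  rw [phiReal_zero hn] at h
  exact h.mono_left nhdsWithin_le_nhds

/-- The inhomogeneous modified Bessel equation satisfied by `phiReal n`. -/
theorem phiReal_ode (n : ℕ) (x : ℝ) :
    x ^ 2 * phiReal'' n x + x * phiReal' n x = 4 * (x ^ 2 + n ^ 2) * phiReal n x - 4 * x := by
  -- Boundary term of the two integrations by parts; its values ±2x at π and 0 produce the source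
  -- 4x.
  have hderiv : ∀ η ∈ uIcc 0 Real.pi, HasDerivAt
      (fun η => Real.exp (-2 * x * Real.sin η) * (2 * n * Real.sin (2 * n * η)
        - 2 * x * Real.cos η * Real.cos (2 * n * η)))
      (4 * (x ^ 2 + n ^ 2) * (Real.exp (-2 * x * Real.sin η) * Real.cos (2 * n * η))
        - (x ^ 2 * (Real.exp (-2 * x * Real.sin η) *
            (-2 * Real.sin η * (-2 * Real.sin η * Real.cos (2 * n * η))))
          + x * (Real.exp (-2 * x * Real.sin η) *
            (-2 * Real.sin η * Real.cos (2 * n * η))))) η := by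
    intro η _
    have h1 : HasDerivAt (fun η : ℝ => 2 * n * η) (2 * n) η := by
      simpa using (hasDerivAt_id η).const_mul (2 * n : ℝ)
    have h2 := ((Real.hasDerivAt_sin η).const_mul (-2 * x)).exp
    have h3 := (h1.sin.const_mul (2 * n : ℝ)).sub
      (((Real.hasDerivAt_cos η).const_mul (2 * x)).mul h1.cos)
    refine (h2.mul h3).congr_deriv ?_
    have hs : Real.cos η ^ 2 = 1 - Real.sin η ^ 2 := by
      linarith [Real.sin_sq_add_cos_sq η]
    simp only [Pi.mul_apply, Pi.sub_apply]
    linear_combination (4 * x ^ 2 * Real.exp (-2 * x * Real.sin η) * Real.cos (2 * n * η)) * hs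
  have hint := intervalIntegral.integral_eq_sub_of_hasDerivAt hderiv
    ((by fun_prop : Continuous _).intervalIntegrable _ _)
  rw [intervalIntegral.integral_sub, intervalIntegral.integral_add,
    intervalIntegral.integral_const_mul, intervalIntegral.integral_const_mul,
    intervalIntegral.integral_const_mul, sin_two_nat_mul_pi, cos_two_nat_mul_pi] at hint
  · simp only [Real.sin_pi, Real.cos_pi, Real.sin_zero, Real.cos_zero, mul_zero, Real.exp_zero]
      at hint
    simp only [phiReal, phiReal', phiReal'', sinLaplace]
    linarith
  all_goals exact (by fun_prop : Continuous _).intervalIntegrable _ _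

theorem phi_eq_ofReal (n : ℕ) (x : ℝ) : phi n x = (phiReal n x : ℂ) := by
  have hexp : ∀ η : ℝ, Complex.exp (((-2 * x * Real.sin η : ℝ) : ℂ)) *
      Complex.exp (Complex.I * (2 * (n : ℂ) * (η : ℂ))) =
      ((Real.exp (-2 * x * Real.sin η) * Real.cos (2 * n * η) : ℝ) : ℂ) +
        ((Real.exp (-2 * x * Real.sin η) * Real.sin (2 * n * η) : ℝ) : ℂ) * Complex.I := by
    intro η
    rw [mul_comm Complex.I, Complex.exp_mul_I]
    push_cast
    ring
  -- The integrand is odd under η ↦ π - η.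
  have hodd : ∫ η in (0 : ℝ)..Real.pi,
      Real.exp (-2 * x * Real.sin η) * Real.sin (2 * n * η) = 0 := by
    have h := intervalIntegral.integral_comp_sub_left (a := 0) (b := Real.pi)
      (fun η => Real.exp (-2 * x * Real.sin η) * Real.sin (2 * n * η)) Real.pi
    have hrefl : ∀ η : ℝ, Real.sin (2 * n * (Real.pi - η)) = -Real.sin (2 * n * η) := by
      intro η
      rw [mul_sub, Real.sin_sub, sin_two_nat_mul_pi, cos_two_nat_mul_pi]
      ring
    simp only [Real.sin_pi_sub, hrefl, mul_neg, intervalIntegral.integral_neg, sub_self,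
      sub_zero] at h
    linarith
  simp only [phi, hexp]
  rw [intervalIntegral.integral_add, intervalIntegral.integral_mul_const,
    intervalIntegral.integral_ofReal, intervalIntegral.integral_ofReal, hodd]
  · simp [phiReal, sinLaplace]
  all_goals exact (by fun_prop : Continuous _).intervalIntegrable _ _

/-! ### Approximate solutions and their Euler defect -/

/-- The profile `x / (x² + m²)`. -/
noncomputable def profile (m x : ℝ) : ℝ := x / (x ^ 2 + m ^ 2)

noncomputable def profile' (m x : ℝ) : ℝ := (m ^ 2 - x ^ 2) / (x ^ 2 + m ^ 2) ^ 2

noncomputable def profile'' (m x : ℝ) : ℝ :=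
  (2 * x ^ 3 - 6 * m ^ 2 * x) / (x ^ 2 + m ^ 2) ^ 3

theorem hasDerivAt_profile {m x : ℝ} (hx : 0 < x) :
    HasDerivAt (profile m) (profile' m x) x := by
  have hne : x ^ 2 + m ^ 2 ≠ 0 := by positivity
  have h1 : HasDerivAt (fun x : ℝ => x ^ 2 + m ^ 2) (2 * x) x := by
    simpa using (hasDerivAt_pow 2 x).add_const (m ^ 2)
  refine ((hasDerivAt_id x).div h1 hne).congr_deriv ?_
  simp only [profile', id]
  congr 1
  ring

theorem hasDerivAt_profile' {m x : ℝ} (hx : 0 < x) :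
    HasDerivAt (profile' m) (profile'' m x) x := by
  have hne : x ^ 2 + m ^ 2 ≠ 0 := by positivity
  have h1 : HasDerivAt (fun x : ℝ => x ^ 2 + m ^ 2) (2 * x) x := by
    simpa using (hasDerivAt_pow 2 x).add_const (m ^ 2)
  have h2 : HasDerivAt (fun x : ℝ => m ^ 2 - x ^ 2) (-(2 * x)) x := by
    simpa using (hasDerivAt_pow 2 x).const_sub (m ^ 2)
  refine (h2.div (h1.pow 2) (pow_ne_zero 2 hne)).congr_deriv ?_
  simp only [profile'', Pi.pow_apply]
  field_simp
  ring

theorem tendsto_profile_zero {m : ℝ} (hm : 0 < m) : Tendsto (profile m) (𝓝[>] 0) (𝓝 0) := by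
  have h : ContinuousAt (profile m) 0 := by
    unfold profile
    exact continuousAt_id.div (by fun_prop) (by positivity)
  have h' := h.tendsto
  simp only [profile, zero_div] at h'
  exact h'.mono_left nhdsWithin_le_nhds

theorem tendsto_profile_atTop (m : ℝ) : Tendsto (profile m) atTop (𝓝 0) := by
  refine squeeze_zero' ?_ ?_ tendsto_inv_atTop_zero
  · filter_upwards [eventually_gt_atTop 0] with x hx
    unfold profile; positivity
  · filter_upwards [eventually_gt_atTop 0] with x hx
    unfold profile
    rw [inv_eq_one_div, div_le_div_iff₀ (by positivity) hx]
    nlinarith [sq_nonneg m]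

/-- `|(x d/dx)² u| ≤ x` for the profile `u` with parameter `m ≥ 1`. -/
theorem abs_euler_profile_le {m x : ℝ} (hm : 1 ≤ m) (hx : 0 < x) :
    |x ^ 2 * profile'' m x + x * profile' m x| ≤ x := by
  have hd : 0 < x ^ 2 + m ^ 2 := by positivity
  have hd1 : 1 ≤ x ^ 2 + m ^ 2 := by nlinarith [sq_nonneg x]
  have heq : x ^ 2 * profile'' m x + x * profile' m x =
      x / (x ^ 2 + m ^ 2) * (1 - 8 * (m ^ 2 * x ^ 2) / (x ^ 2 + m ^ 2) ^ 2) := by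
    unfold profile' profile''
    field_simp
    ring
  have hs : 8 * (m ^ 2 * x ^ 2) / (x ^ 2 + m ^ 2) ^ 2 ≤ 2 := by
    rw [div_le_iff₀ (by positivity)]
    nlinarith [sq_nonneg (x ^ 2 - m ^ 2)]
  have hs0 : 0 ≤ 8 * (m ^ 2 * x ^ 2) / (x ^ 2 + m ^ 2) ^ 2 := by positivity
  have hu : x / (x ^ 2 + m ^ 2) ≤ x := div_le_self hx.le hd1
  have hu0 : 0 < x / (x ^ 2 + m ^ 2) := by positivity
  rw [heq, abs_mul, abs_of_pos hu0]
  have : |1 - 8 * (m ^ 2 * x ^ 2) / (x ^ 2 + m ^ 2) ^ 2| ≤ 1 := abs_le.2 ⟨by linarith, by linarith⟩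
  nlinarith

/-! ### Comparison with the profiles -/

/-- As |E u_n| ≤ x, the multiple c u_n is a subsolution when 5c ≤ 4 and a supersolution when 3c ≥ 4.
-/
theorem phiReal_bounds {n : ℕ} (hn : 1 ≤ n) {x : ℝ} (hx : 0 < x) :
    4 / 5 * profile n x ≤ phiReal n x ∧ phiReal n x ≤ 4 / 3 * profile n x := by
  have hn1 : (1 : ℝ) ≤ n := by exact_mod_cast hn
  have hq : ∀ y : ℝ, 0 < y → 0 < 4 * (y ^ 2 + (n : ℝ) ^ 2) := fun y hy => by positivity
  have hprof : ∀ y : ℝ, 0 < y → 4 * (y ^ 2 + (n : ℝ) ^ 2) * profile n y = 4 * y := by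
    intro y hy
    have : y ^ 2 + (n : ℝ) ^ 2 ≠ 0 := by positivity
    unfold profile
    field_simp
  constructor
  · rw [← sub_nonneg]
    refine nonneg_of_euler_supersolution (f := fun y => phiReal n y - 4 / 5 * profile n y)
      (fun y hy => (hasDerivAt_phiReal n y).sub ((hasDerivAt_profile hy).const_mul _))
      (fun y hy => (hasDerivAt_phiReal' n y).sub ((hasDerivAt_profile' hy).const_mul _))
      hq (fun y hy => ?_) ?_ ?_ x hx
    · have h1 := phiReal_ode n y
      have h2 := (abs_le.1 (abs_euler_profile_le hn1 hy)).1
      have h3 := hprof y hy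
      linarith
    · simpa using (tendsto_phiReal_zero hn).sub
        ((tendsto_profile_zero (by linarith : (0 : ℝ) < n)).const_mul (4 / 5))
    · simpa using (tendsto_phiReal_atTop n).sub ((tendsto_profile_atTop n).const_mul (4 / 5))
  · rw [← sub_nonneg]
    refine nonneg_of_euler_supersolution (f := fun y => 4 / 3 * profile n y - phiReal n y)
      (fun y hy => ((hasDerivAt_profile hy).const_mul _).sub (hasDerivAt_phiReal n y))
      (fun y hy => ((hasDerivAt_profile' hy).const_mul _).sub (hasDerivAt_phiReal' n y))
      hq (fun y hy => ?_) ?_ ?_ x hx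
    · have h1 := phiReal_ode n y
      have h2 := (abs_le.1 (abs_euler_profile_le hn1 hy)).2
      have h3 := hprof y hy
      linarith
    · simpa using ((tendsto_profile_zero (by linarith : (0 : ℝ) < n)).const_mul (4 / 3)).sub
        (tendsto_phiReal_zero hn)
    · simpa using ((tendsto_profile_atTop n).const_mul (4 / 3)).sub (tendsto_phiReal_atTop n)

theorem profile_sub_profile {m x : ℝ} (hx : 0 < x) :
    profile m x - profile (m + 1) x =
      (2 * m + 1) * x / ((m ^ 2 + x ^ 2) * ((m + 1) ^ 2 + x ^ 2)) := by
  have h1 : x ^ 2 + m ^ 2 ≠ 0 := by positivity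
  have h2 : x ^ 2 + (m + 1) ^ 2 ≠ 0 := by positivity
  unfold profile
  rw [add_comm (m ^ 2), add_comm ((m + 1) ^ 2)]
  field_simp
  ring

/-- Two-sided bound for `(x d/dx)²` applied to the difference of consecutive profiles. -/
theorem euler_profile_sub_bounds {m x : ℝ} (hm : 1 ≤ m) (hx : 0 < x) :
    -2 * (profile m x - profile (m + 1) x) ≤
      x ^ 2 * (profile'' m x - profile'' (m + 1) x) + x * (profile' m x - profile' (m + 1) x) ∧
    x ^ 2 * (profile'' m x - profile'' (m + 1) x) + x * (profile' m x - profile' (m + 1) x) ≤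
      (1 + 2 * x ^ 2) * (profile m x - profile (m + 1) x) := by
  have h1 : x ^ 2 + m ^ 2 ≠ 0 := by positivity
  have h2 : x ^ 2 + (m + 1) ^ 2 ≠ 0 := by positivity
  obtain ⟨a, ha⟩ : ∃ a, a = x ^ 2 / (x ^ 2 + m ^ 2) := ⟨_, rfl⟩
  obtain ⟨b, hb⟩ : ∃ b, b = x ^ 2 / (x ^ 2 + (m + 1) ^ 2) := ⟨_, rfl⟩
  have hW : 0 ≤ profile m x - profile (m + 1) x := by
    rw [profile_sub_profile hx]; positivity
  have ha0 : 0 ≤ a := by rw [ha]; positivity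
  have hb0 : 0 ≤ b := by rw [hb]; positivity
  have ha1 : a ≤ 1 := by
    rw [ha, div_le_one (by positivity)]; nlinarith
  have hb1 : b ≤ 1 := by
    rw [hb, div_le_one (by positivity)]; nlinarith
  have hb2 : 4 * b ≤ x ^ 2 := by
    rw [hb, ← mul_div_assoc, div_le_iff₀ (by positivity)]
    have : 4 ≤ x ^ 2 + (m + 1) ^ 2 := by nlinarith [sq_nonneg x]
    nlinarith [sq_nonneg x]
  have heq : x ^ 2 * (profile'' m x - profile'' (m + 1) x)
      + x * (profile' m x - profile' (m + 1) x) =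
      (1 - 8 * (a + b) + 8 * (a ^ 2 + b ^ 2 + a * b)) *
        (profile m x - profile (m + 1) x) := by
    rw [ha, hb]
    unfold profile profile' profile''
    field_simp
    ring
  rw [heq]
  constructor
  -- With s = a + b the factor is 1 - 8s + 6s² + 2(a - b)², at least -5/3.
  · refine mul_le_mul_of_nonneg_right ?_ hW
    nlinarith [sq_nonneg (a - b), sq_nonneg (3 * (a + b) - 2)]
  -- On [0,1] the factor is at most 1 + 8ab ≤ 1 + 8b ≤ 1 + 2x².
  · refine mul_le_mul_of_nonneg_right ?_ hW
    nlinarith [mul_nonneg ha0 (sub_nonneg.2 ha1), mul_nonneg hb0 (sub_nonneg.2 hb1),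
      mul_nonneg hb0 (sub_nonneg.2 ha1)]

theorem phiReal_sub_bounds {n : ℕ} (hn : 1 ≤ n) {x : ℝ} (hx : 0 < x) :
    1 / 2 * (profile n x - profile (n + 1) x) ≤ phiReal n x - phiReal (n + 1) x ∧
    phiReal n x - phiReal (n + 1) x ≤ 4 * (profile n x - profile (n + 1) x) := by
  have hn1 : (1 : ℝ) ≤ n := by exact_mod_cast hn
  have hn0 : (0 : ℝ) < n := by linarith
  have hq : ∀ y : ℝ, 0 < y → 0 < 4 * (y ^ 2 + (n : ℝ) ^ 2) := fun y hy => by positivity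
  have hprof : ∀ y : ℝ, 0 < y → 4 * (y ^ 2 + (n : ℝ) ^ 2) *
      (profile n y - profile (n + 1) y) = 4 * ((2 * n + 1) * profile (n + 1) y) := by
    intro y hy
    have h1 : y ^ 2 + (n : ℝ) ^ 2 ≠ 0 := by positivity
    have h2 : y ^ 2 + ((n : ℝ) + 1) ^ 2 ≠ 0 := by positivity
    unfold profile
    field_simp
    ring
  have hW : ∀ y : ℝ, 0 < y → 0 ≤ profile n y - profile (n + 1) y := by
    intro y hy
    rw [profile_sub_profile hy]; positivity
  have hnext : ∀ y : ℝ, 0 < y →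
      (2 * n + 1) * (4 / 5 * profile (n + 1) y) ≤ (2 * n + 1) * phiReal (n + 1) y ∧
      (2 * n + 1) * phiReal (n + 1) y ≤ (2 * n + 1) * (4 / 3 * profile (n + 1) y) := by
    intro y hy
    have h := phiReal_bounds (n := n + 1) (by omega) hy
    push_cast at h
    exact ⟨mul_le_mul_of_nonneg_left h.1 (by positivity),
      mul_le_mul_of_nonneg_left h.2 (by positivity)⟩
  have hode : ∀ y : ℝ, y ^ 2 * (phiReal'' n y - phiReal'' (n + 1) y)
      + y * (phiReal' n y - phiReal' (n + 1) y) =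
      4 * (y ^ 2 + (n : ℝ) ^ 2) * (phiReal n y - phiReal (n + 1) y)
        - 4 * ((2 * n + 1) * phiReal (n + 1) y) := by
    intro y
    have h1 := phiReal_ode n y
    have h2 := phiReal_ode (n + 1) y
    push_cast at h2
    linear_combination h1 - h2
  have hφ0 := (tendsto_phiReal_zero hn).sub (tendsto_phiReal_zero (n := n + 1) (by omega))
  have hφtop := (tendsto_phiReal_atTop n).sub (tendsto_phiReal_atTop (n + 1))
  have hu0 := (tendsto_profile_zero hn0).sub
    (tendsto_profile_zero (m := (n : ℝ) + 1) (by positivity))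
  have hutop := (tendsto_profile_atTop n).sub (tendsto_profile_atTop ((n : ℝ) + 1))
  have hφd := fun y : ℝ => (hasDerivAt_phiReal n y).sub (hasDerivAt_phiReal (n + 1) y)
  have hφd' := fun y : ℝ => (hasDerivAt_phiReal' n y).sub (hasDerivAt_phiReal' (n + 1) y)
  have hud := fun (y : ℝ) (hy : 0 < y) =>
    (hasDerivAt_profile (m := n) hy).sub (hasDerivAt_profile (m := n + 1) hy)
  have hud' := fun (y : ℝ) (hy : 0 < y) =>
    (hasDerivAt_profile' (m := n) hy).sub (hasDerivAt_profile' (m := n + 1) hy)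
  constructor
  · rw [← sub_nonneg]
    refine nonneg_of_euler_supersolution
      (f := fun y => phiReal n y - phiReal (n + 1) y
        - 1 / 2 * (profile n y - profile (n + 1) y))
      (fun y hy => (hφd y).sub ((hud y hy).const_mul _))
      (fun y hy => (hφd' y).sub ((hud' y hy).const_mul _))
      hq (fun y hy => ?_) ?_ ?_ x hx
    · have h1 := hode y
      have h2 := (euler_profile_sub_bounds hn1 hy).1
      have h3 := hprof y hy
      have h4 := (hnext y hy).1
      have h5 := hW y hy
      -- Since q_n ≥ 4, the defect costs at most q_n W/4, where W = u_n - u_{n+1}; 4/5 - 1/4 ≥ 1/2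
      -- closes the comparison.
      have h6 : 4 * (profile n y - profile (n + 1) y) ≤
          4 * (y ^ 2 + (n : ℝ) ^ 2) * (profile n y - profile (n + 1) y) :=
        mul_le_mul_of_nonneg_right (by nlinarith [sq_nonneg y]) h5
      linarith
    · simpa using hφ0.sub (hu0.const_mul (2⁻¹ : ℝ))
    · simpa using hφtop.sub (hutop.const_mul (2⁻¹ : ℝ))
  · rw [← sub_nonneg]
    refine nonneg_of_euler_supersolution
      (f := fun y => 4 * (profile n y - profile (n + 1) y)
        - (phiReal n y - phiReal (n + 1) y))
      (fun y hy => ((hud y hy).const_mul _).sub (hφd y))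
      (fun y hy => ((hud' y hy).const_mul _).sub (hφd' y))
      hq (fun y hy => ?_) ?_ ?_ x hx
    · have h1 := hode y
      have h2 := (euler_profile_sub_bounds hn1 hy).2
      have h3 := hprof y hy
      have h4 := (hnext y hy).2
      -- The defect absorbs 2/3 of q_n W, so a constant c needs c/3 ≥ 4/3, whence 4.
      have h6 : (1 + 2 * y ^ 2) * (profile n y - profile (n + 1) y) ≤
          2 / 3 * (4 * (y ^ 2 + (n : ℝ) ^ 2)) * (profile n y - profile (n + 1) y) :=
        mul_le_mul_of_nonneg_right (by nlinarith [sq_nonneg y]) (hW y hy)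
      linarith
    · simpa using (hu0.const_mul 4).sub hφ0
    · simpa using (hutop.const_mul 4).sub hφtop

theorem proposition3p5 (n : ℕ) (hn : 1 ≤ n) (x : ℝ) (hx : 0 < x) :
    (phi n x).im = 0 ∧ (phi (n + 1) x).im = 0 ∧
    (1 / 2 : ℝ) * ((2 * (n : ℝ) + 1) * x /
        (((n : ℝ) ^ 2 + x ^ 2) * (((n : ℝ) + 1) ^ 2 + x ^ 2)))
      ≤ (phi n x - phi (n + 1) x).re ∧
    (phi n x - phi (n + 1) x).re
      ≤ 4 * ((2 * (n : ℝ) + 1) * x /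
        (((n : ℝ) ^ 2 + x ^ 2) * (((n : ℝ) + 1) ^ 2 + x ^ 2))) := by
  have h := phiReal_sub_bounds hn hx
  rw [profile_sub_profile hx] at h
  rw [phi_eq_ofReal, phi_eq_ofReal, ← Complex.ofReal_sub, Complex.ofReal_re]
  exact ⟨Complex.ofReal_im _, Complex.ofReal_im _, h⟩
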